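/- For $M>0$ let $\mathcal F_M$ be the class of probability densities $f$ on $(0,\infty)$ with $f(\tau)\le M$ for all $\tau>0$ and $f(\tau)>1/M$ for all $\tau\in(0,1)$. For $f\in\mathcal F_M$ and $n\ge 1$ let $\theta\in\mathbb R^n$ be drawn as follows: $\tau$ has density $f$ and, given $\tau$, the coordinates $\theta_1,\dots,\theta_n$ are independent with $\theta_j\sim N(0,\tau)$ (variance $\tau$). For $\delta\in(0,1)$ put $t_n=n^{\delta/2}$. For every $M>0$ there are constants $C_1,C_2,c_2>0$, depending only on $M$, such that for every $\delta\in(0,1)$ the following holds. (a) For every $f\in\mathcal F_M$ and every $n\ge1$, $$C_1e^{-(1-\delta)\log n}\le \mathbb P(\|\theta\|_2<t_n)\le C_2e^{-(1-\delta)\log n}.$$ (b) For every $f\in\mathcal F_M$, every $n\ge1$ and every $\theta_0\in\mathbb R^n$ with $\|\theta_0\|_2>t_n$, with $a_n=\|\theta_0\|_2/t_n>1$, $$\mathbb P(\|\theta-\theta_0\|_2<t_n)\le e^{-c_2 n\log a_n}.$$ (c) For every $\eta>0$ there is a constant $c_1>0$, depending only on $M$, $\delta$ and $\eta$, such that for every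 sequence $\theta_0=\theta_0^{(n)}\in\mathbb R^n$ with $\|\theta_0\|_2=o(\sqrt n)$ the following holds for all sufficiently large $n$: for every $f\in\mathcal F_M$, if $a_n=\|\theta_0\|_2/t_n\ge 1+\eta$, then $$\mathbb P(\|\theta-\theta_0\|_2<t_n)\ge e^{-c_1 n\log a_n}.$$ -/

import Mathlib

open MeasureTheory ProbabilityTheory Filter Asymptotics

/-- The class `𝓕` with constant `M`: probability densities on `(0, ∞)` that are bounded by `M`
on `(0, ∞)` and exceed `1 / M` on `(0, 1)`. Values of `f` outside `(0, ∞)` play no role. -/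
structure IsClassF (M : ℝ) (f : ℝ → ℝ) : Prop where
  measurable : Measurable f
  nonneg : ∀ τ, 0 < τ → 0 ≤ f τ
  integral_eq_one : ∫ τ in Set.Ioi (0 : ℝ), f τ = 1
  le_bound : ∀ τ, 0 < τ → f τ ≤ M
  lower_bound : ∀ τ, 0 < τ → τ < 1 → 1 / M < f τ

/-- The law on `(0, ∞)` of the global parameter `τ` with density `f`. -/
noncomputable def tauLaw (f : ℝ → ℝ) : Measure ℝ :=
  (volume.restrict (Set.Ioi (0 : ℝ))).withDensity (fun τ => ENNReal.ofReal (f τ))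

/-- The conditional law of `θ` given `τ`: independent coordinates `θ_j ~ N(0, τ)`
(variance `τ`), as a measure on Euclidean space. -/
noncomputable def condLaw (n : ℕ) (τ : ℝ) : Measure (EuclideanSpace ℝ (Fin n)) :=
  (Measure.pi (fun _ : Fin n => gaussianReal 0 τ.toNNReal)).map (WithLp.toLp 2)

theorem condLaw_eq_map (n : ℕ) (τ : ℝ) :
    condLaw n τ = (Measure.pi (fun _ : Fin n => gaussianReal 0 1)).map
      (fun z => WithLp.toLp 2 (fun i => Real.sqrt τ * z i)) := by
  have h : gaussianReal 0 τ.toNNReal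
      = (gaussianReal 0 1).map (fun x => Real.sqrt τ * x) := by
    rw [gaussianReal_map_const_mul]
    congr 1
    · simp
    · ext
      by_cases hτ : 0 ≤ τ
      · simp [Real.sq_sqrt hτ, hτ]
      · have hτ' : τ ≤ 0 := le_of_not_ge hτ
        simp [Real.sqrt_eq_zero_of_nonpos hτ', hτ']
  have h2 : Measure.pi (fun _ : Fin n => gaussianReal 0 τ.toNNReal)
      = (Measure.pi (fun _ : Fin n => gaussianReal 0 1)).map
        (fun z i => Real.sqrt τ * z i) := by
    rw [h]
    have : IsProbabilityMeasure ((gaussianReal 0 1).map (fun x => Real.sqrt τ * x)) := by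
      rw [← h]; infer_instance
    exact (Measure.pi_map_pi (μ := fun _ : Fin n => gaussianReal 0 1)
      (f := fun _ x => Real.sqrt τ * x) (fun _ => by fun_prop)).symm
  rw [condLaw, h2, Measure.map_map (by fun_prop) (by fun_prop)]
  rfl

theorem measurable_condLaw (n : ℕ) : Measurable (condLaw n) := by
  refine Measure.measurable_of_measurable_coe _ fun s hs => ?_
  have hF : Measurable (fun p : ℝ × (Fin n → ℝ) =>
      (WithLp.toLp 2 (fun i => Real.sqrt p.1 * p.2 i) : EuclideanSpace ℝ (Fin n))) := by
    fun_prop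
  have h := measurable_measure_prodMk_left
    (ν := Measure.pi (fun _ : Fin n => gaussianReal 0 1)) (hF hs)
  convert h using 2 with τ
  rw [condLaw_eq_map, Measure.map_apply (by fun_prop) hs]
  rfl

/-- `condLaw n` as a Markov kernel from `τ` to `θ`. -/
noncomputable def condKernel (n : ℕ) : Kernel ℝ (EuclideanSpace ℝ (Fin n)) where
  toFun := condLaw n
  measurable' := measurable_condLaw n

/-- The marginal prior law of `θ ∈ ℝⁿ`: `τ ~ f`, and given `τ`, `θ_j ~ N(0, τ)` independently. -/
noncomputable def globalPrior (f : ℝ → ℝ) (n : ℕ) : Measure (EuclideanSpace ℝ (Fin n)) :=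
  (tauLaw f).bind (condKernel n)

/-- The radius `t_n = n^{δ/2}`. -/
noncomputable def tRad (δ : ℝ) (n : ℕ) : ℝ := (n : ℝ) ^ (δ / 2)

/-- The prior concentration `P(‖θ - θ₀‖₂ < t)`. -/
noncomputable def priorConc (f : ℝ → ℝ) (n : ℕ) (θ₀ : EuclideanSpace ℝ (Fin n)) (t : ℝ) : ℝ :=
  (globalPrior f n).real {θ | ‖θ - θ₀‖ < t}

/-! Everything is an estimate at fixed `τ`, then averaged over `τ`. The upper bounds are Chernoff
bounds from the explicit Gaussian Laplace transform. For (b), a suitable parameter gives `a⁻ⁿ`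
uniformly in `τ` (`condLaw_real_ball_le_div_pow`), so `c₂ = 1`. For (a), the parameter `1/t²` gives
a power of `1 + 2τ/t²` whose integral over `τ` is of order `t²/n`; the matching lower bound comes
from `τ < t²/(2n)`, where Markov's inequality gives the ball mass at least `1/2`. For (c), take `τ`
between `‖θ₀‖²/n` and `2‖θ₀‖²/n`, so that typical `θ` are about as long as `θ₀`. A cube inscribed in
the ball then has mass at least `exp(-n(log a + 3))` (`le_condLaw_real_ball`), and `a ≥ 1 + η` lets
`log a` absorb the additive constants. -/

/-! ### Gaussian mass of balls at fixed `τ` -/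

/-- The Laplace transform of the squared distance to `m` under a centred Gaussian. -/
theorem integral_exp_neg_mul_sub_sq_gaussianReal {τ l : ℝ} (hτ : 0 < τ) (hl : 0 ≤ l) (m : ℝ) :
    ∫ x, Real.exp (-l * (x - m) ^ 2) ∂(gaussianReal 0 τ.toNNReal)
      = (√(1 + 2 * l * τ))⁻¹ * Real.exp (-(l / (1 + 2 * l * τ)) * m ^ 2) := by
  have hv : τ.toNNReal ≠ 0 := by simpa using hτ
  have hs : 0 < 1 + 2 * l * τ := by positivity
  rw [integral_gaussianReal_eq_integral_smul hv]
  -- Complete the square in `x`.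
  have h : ∀ x : ℝ, gaussianPDFReal 0 τ.toNNReal x • Real.exp (-l * (x - m) ^ 2)
      = ((√(2 * Real.pi * τ))⁻¹ * Real.exp (-(l / (1 + 2 * l * τ)) * m ^ 2)) *
        Real.exp (-((1 + 2 * l * τ) / (2 * τ)) * (x - 2 * l * τ * m / (1 + 2 * l * τ)) ^ 2) := by
    intro x
    rw [gaussianPDFReal, Real.coe_toNNReal _ hτ.le, smul_eq_mul, mul_assoc (√_)⁻¹,
      mul_assoc (√_)⁻¹, ← Real.exp_add, ← Real.exp_add]
    congr 2
    field_simp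
    ring
  simp_rw [h]
  rw [integral_const_mul, integral_sub_right_eq_self
    (fun x => Real.exp (-((1 + 2 * l * τ) / (2 * τ)) * x ^ 2)), integral_gaussian]
  have h2 : Real.pi / ((1 + 2 * l * τ) / (2 * τ)) = (2 * Real.pi * τ) / (1 + 2 * l * τ) := by
    field_simp
  rw [h2, Real.sqrt_div (by positivity)]
  have : √(2 * Real.pi * τ) ≠ 0 := by positivity
  field_simp

theorem integral_condLaw_exp_neg_mul_norm_sub_sq (n : ℕ) {τ l : ℝ} (hτ : 0 < τ) (hl : 0 ≤ l)
    (θ₀ : EuclideanSpace ℝ (Fin n)) :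
    ∫ θ, Real.exp (-l * ‖θ - θ₀‖ ^ 2) ∂(condLaw n τ)
      = (√(1 + 2 * l * τ))⁻¹ ^ n * Real.exp (-(l / (1 + 2 * l * τ)) * ‖θ₀‖ ^ 2) := by
  rw [condLaw, integral_map (by fun_prop) (by fun_prop)]
  have h : ∀ x : Fin n → ℝ, Real.exp (-l * ‖WithLp.toLp 2 x - θ₀‖ ^ 2)
      = ∏ i, Real.exp (-l * (x i - θ₀ i) ^ 2) := by
    intro x
    rw [EuclideanSpace.real_norm_sq_eq, Finset.mul_sum, Real.exp_sum]
    rfl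
  simp_rw [h]
  rw [integral_fintype_prod_eq_prod (fun i x => Real.exp (-l * (x - θ₀ i) ^ 2))]
  simp_rw [integral_exp_neg_mul_sub_sq_gaussianReal hτ hl]
  rw [Finset.prod_mul_distrib, ← Real.exp_sum, ← Finset.mul_sum,
    EuclideanSpace.real_norm_sq_eq]
  simp

instance isProbabilityMeasure_condLaw (n : ℕ) (τ : ℝ) : IsProbabilityMeasure (condLaw n τ) :=
  Measure.isProbabilityMeasure_map (by fun_prop)

/-- Chernoff bound for the Gaussian mass of a ball. -/
theorem condLaw_real_ball_le (n : ℕ) {τ l : ℝ} (hτ : 0 < τ) (hl : 0 ≤ l) {t : ℝ}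
    (θ₀ : EuclideanSpace ℝ (Fin n)) :
    (condLaw n τ).real {θ | ‖θ - θ₀‖ < t}
      ≤ Real.exp (l * t ^ 2) * ((√(1 + 2 * l * τ))⁻¹ ^ n *
        Real.exp (-(l / (1 + 2 * l * τ)) * ‖θ₀‖ ^ 2)) := by
  have hmeas : MeasurableSet {θ : EuclideanSpace ℝ (Fin n) | ‖θ - θ₀‖ < t} :=
    measurableSet_lt (by fun_prop) (by fun_prop)
  have hint : Integrable (fun θ => Real.exp (-l * ‖θ - θ₀‖ ^ 2)) (condLaw n τ) := by
    refine Integrable.of_bound (C := 1) (by fun_prop) (Eventually.of_forall fun θ => ?_)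
    rw [Real.norm_eq_abs, abs_of_pos (Real.exp_pos _), Real.exp_le_one_iff]
    nlinarith [mul_nonneg hl (sq_nonneg ‖θ - θ₀‖)]
  rw [← integral_condLaw_exp_neg_mul_norm_sub_sq n hτ hl, ← integral_const_mul,
    ← integral_indicator_one hmeas]
  refine integral_mono_of_nonneg (Eventually.of_forall fun θ => ?_) (hint.const_mul _)
    (Eventually.of_forall fun θ => ?_)
  · exact Set.indicator_nonneg (fun _ _ => zero_le_one) _
  · rw [Set.indicator_apply]
    split_ifs with h
    · simp only [Pi.one_apply]
      rw [← Real.exp_add, Real.one_le_exp_iff]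
      have : ‖θ - θ₀‖ ^ 2 ≤ t ^ 2 := pow_le_pow_left₀ (norm_nonneg _) (le_of_lt h) 2
      nlinarith
    · positivity

/-- The Chernoff parameter is chosen so that `1 + 2lτ = a²`; the two exponentials then cancel
exactly and `τ` disappears. -/
theorem condLaw_real_ball_le_div_pow (n : ℕ) {τ t : ℝ} (hτ : 0 < τ) (ht : 0 < t)
    (θ₀ : EuclideanSpace ℝ (Fin n)) (h : t < ‖θ₀‖) :
    (condLaw n τ).real {θ | ‖θ - θ₀‖ < t} ≤ (‖θ₀‖ / t)⁻¹ ^ n := by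
  set a := ‖θ₀‖ / t with ha
  have ha1 : 1 < a := by rwa [ha, one_lt_div ht]
  have hθ : ‖θ₀‖ = a * t := by rw [ha]; field_simp
  have hl : 0 ≤ (a ^ 2 - 1) / (2 * τ) := div_nonneg (by nlinarith) (by positivity)
  refine (condLaw_real_ball_le n hτ hl θ₀).trans (le_of_eq ?_)
  have hs : 1 + 2 * ((a ^ 2 - 1) / (2 * τ)) * τ = a ^ 2 := by field_simp; ring
  rw [hs, Real.sqrt_sq (by linarith), mul_left_comm, ← Real.exp_add, hθ]
  have : (a ^ 2 - 1) / (2 * τ) * t ^ 2 + -((a ^ 2 - 1) / (2 * τ) / a ^ 2) * (a * t) ^ 2 = 0 := by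
    field_simp
    ring
  rw [this, Real.exp_zero, mul_one]

theorem integral_condLaw_norm_sq (n : ℕ) {τ : ℝ} (hτ : 0 < τ) :
    Integrable (fun θ => ‖θ‖ ^ 2) (condLaw n τ) ∧ ∫ θ, ‖θ‖ ^ 2 ∂(condLaw n τ) = n * τ := by
  have hi : ∀ i ∈ (Finset.univ : Finset (Fin n)), Integrable (fun x : Fin n → ℝ => x i ^ 2)
      (Measure.pi (fun _ : Fin n => gaussianReal 0 τ.toNNReal)) := fun i _ =>
    (measurePreserving_eval (fun _ : Fin n => gaussianReal 0 τ.toNNReal)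
      i).integrable_comp_of_integrable
      (g := fun x : ℝ => x ^ 2) (memLp_id_gaussianReal 2).integrable_sq
  have hn : ∀ x : Fin n → ℝ, ‖(WithLp.toLp 2 x : EuclideanSpace ℝ (Fin n))‖ ^ 2
      = ∑ i, x i ^ 2 := fun x => EuclideanSpace.real_norm_sq_eq _
  constructor
  · rw [condLaw, integrable_map_measure (by fun_prop) (by fun_prop)]
    refine (integrable_finsetSum _ hi).congr (Eventually.of_forall fun x => ?_)
    simp [hn]
  · rw [condLaw, integral_map (by fun_prop) (by fun_prop)]
    simp_rw [hn]
    rw [integral_finsetSum _ hi]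
    have : ∀ i : Fin n, ∫ x : Fin n → ℝ, x i ^ 2
        ∂(Measure.pi (fun _ : Fin n => gaussianReal 0 τ.toNNReal)) = τ := by
      intro i
      rw [integral_comp_eval (μ := fun _ : Fin n => gaussianReal 0 τ.toNNReal) (i := i)
        (f := fun x : ℝ => x ^ 2) (by fun_prop)]
      have h := variance_id_gaussianReal (μ := 0) (v := τ.toNNReal)
      rw [variance_of_integral_eq_zero (by fun_prop) (by simp)] at h
      simpa [hτ.le] using h
    simp [this]

/-- Markov's inequality for `‖θ‖²`, whose mean is `nτ`. -/
theorem half_le_condLaw_real_ball (n : ℕ) {τ t : ℝ} (hτ : 0 < τ) (ht : 0 < t)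
    (h : 2 * (n * τ) ≤ t ^ 2) : 1 / 2 ≤ (condLaw n τ).real {θ | ‖θ‖ < t} := by
  obtain ⟨hint, hval⟩ := integral_condLaw_norm_sq n hτ
  have hm := mul_meas_ge_le_integral_of_nonneg (Eventually.of_forall fun θ => by positivity)
    hint (t ^ 2)
  have hc : {θ : EuclideanSpace ℝ (Fin n) | t ^ 2 ≤ ‖θ‖ ^ 2} = {θ | ‖θ‖ < t}ᶜ := by
    ext θ
    simp only [Set.mem_ofPred_eq, Set.mem_compl_iff, not_lt]
    exact pow_le_pow_iff_left₀ ht.le (norm_nonneg _) two_ne_zero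
  rw [hc, probReal_compl_eq_one_sub (measurableSet_lt (by fun_prop) (by fun_prop)), hval] at hm
  have ht2 : 0 < t ^ 2 := by positivity
  nlinarith

theorem le_gaussianReal_real_Ioo {τ h : ℝ} (hτ : 0 < τ) (hh : 0 ≤ h) (hhτ : h ^ 2 ≤ τ) (m : ℝ) :
    2 * h * ((√(2 * Real.pi * τ))⁻¹ * Real.exp (-1 - m ^ 2 / τ))
      ≤ (gaussianReal 0 τ.toNNReal).real (Set.Ioo (m - h) (m + h)) := by
  have hv : τ.toNNReal ≠ 0 := by simpa using hτ
  rw [measureReal_def, gaussianReal_apply_eq_integral _ hv, ENNReal.toReal_ofReal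
    (setIntegral_nonneg measurableSet_Ioo fun x _ => gaussianPDFReal_nonneg _ _ x)]
  have hc : ∫ x in Set.Ioo (m - h) (m + h), (√(2 * Real.pi * τ))⁻¹ * Real.exp (-1 - m ^ 2 / τ)
      = 2 * h * ((√(2 * Real.pi * τ))⁻¹ * Real.exp (-1 - m ^ 2 / τ)) := by
    rw [setIntegral_const, Real.volume_real_Ioo_of_le (by linarith), smul_eq_mul]
    ring
  rw [← hc]
  refine setIntegral_mono_on (integrableOn_const (by simp)) (integrable_gaussianPDFReal _ _).integrableOn
    measurableSet_Ioo fun x hx => ?_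
  rw [gaussianPDFReal, Real.coe_toNNReal _ hτ.le]
  gcongr
  have h1 : (x - m) ^ 2 ≤ h ^ 2 := sq_le_sq' (by linarith [hx.1]) (by linarith [hx.2])
  have h2 : -1 - m ^ 2 / τ = -(τ + m ^ 2) / τ := by field_simp; ring
  rw [h2, div_le_div_iff₀ hτ (by positivity)]
  -- The square encodes `x² ≤ 2(x - m)² + 2m²`.
  nlinarith [sq_nonneg (x - 2 * m)]

/-- The ball contains the cube of half-side `t/√n` about `θ₀`, whose mass factorises. In the `3`,
one unit pays for the normalising constants (`hfac`) and two for `exp(-n - ‖θ₀‖²/τ) ≥ exp(-2n)`. -/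
theorem le_condLaw_real_ball {n : ℕ} (hn : 1 ≤ n) {τ t : ℝ} (hτ : 0 < τ) (ht : 0 < t)
    (θ₀ : EuclideanSpace ℝ (Fin n)) (h1 : t ≤ ‖θ₀‖) (h2 : ‖θ₀‖ ^ 2 ≤ n * τ)
    (h3 : n * τ ≤ 2 * ‖θ₀‖ ^ 2) :
    Real.exp (-(n * (Real.log (‖θ₀‖ / t) + 3))) ≤ (condLaw n τ).real {θ | ‖θ - θ₀‖ < t} := by
  have hn0 : (0 : ℝ) < n := by exact_mod_cast hn
  set r := ‖θ₀‖ with hr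
  have hr0 : 0 < r := ht.trans_le h1
  have hsub : (WithLp.toLp 2 ⁻¹' {θ : EuclideanSpace ℝ (Fin n) | ‖θ - θ₀‖ < t}) ⊇
      Set.univ.pi fun i => Set.Ioo (θ₀ i - t / √n) (θ₀ i + t / √n) := by
    intro x hx
    have hx' : ∀ i, (x i - θ₀ i) ^ 2 < t ^ 2 / n := by
      intro i
      have := hx i trivial
      have h4 : (t / √n) ^ 2 = t ^ 2 / n := by rw [div_pow, Real.sq_sqrt hn0.le]
      rw [← h4]
      exact sq_lt_sq' (by linarith [this.1]) (by linarith [this.2])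
    have : ‖(WithLp.toLp 2 x : EuclideanSpace ℝ (Fin n)) - θ₀‖ ^ 2 < t ^ 2 := by
      rw [EuclideanSpace.real_norm_sq_eq]
      have : Nonempty (Fin n) := ⟨⟨0, hn⟩⟩
      calc ∑ i, (x i - θ₀ i) ^ 2 < ∑ _i : Fin n, t ^ 2 / n :=
            Finset.sum_lt_sum_of_nonempty Finset.univ_nonempty fun i _ => hx' i
        _ = t ^ 2 := by simp; field_simp
    exact lt_of_pow_lt_pow_left₀ 2 ht.le this
  rw [condLaw, map_measureReal_apply (by fun_prop)
    (measurableSet_lt (by fun_prop) (by fun_prop))]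
  refine le_trans ?_ (measureReal_mono hsub)
  rw [measureReal_def, Measure.pi_pi, ENNReal.toReal_prod]
  have hhτ : (t / √n) ^ 2 ≤ τ := by
    rw [div_pow, Real.sq_sqrt hn0.le, div_le_iff₀ hn0]
    nlinarith
  refine le_trans ?_ (Finset.prod_le_prod (fun i _ => by positivity) fun i _ =>
    le_gaussianReal_real_Ioo hτ (div_nonneg ht.le (Real.sqrt_nonneg _)) hhτ (θ₀ i))
  have hfac : Real.exp (-(Real.log (r / t) + 1)) ≤ 2 * (t / √n) * (√(2 * Real.pi * τ))⁻¹ := by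
    have hs : √(2 * Real.pi * τ) * √n ≤ 4 * r := by
      rw [← Real.sqrt_mul (by positivity)]
      apply Real.sqrt_le_iff.2 ⟨by positivity, ?_⟩
      nlinarith [Real.pi_lt_four, Real.pi_pos, mul_pos Real.pi_pos (mul_pos hn0 hτ), sq_nonneg r]
    have he : 2 ≤ Real.exp 1 := by linarith [Real.add_one_le_exp (1 : ℝ)]
    rw [Real.exp_neg, Real.exp_add, Real.exp_log (by positivity)]
    have e1 : 2 * (t / √n) * (√(2 * Real.pi * τ))⁻¹ = (2 * t) / (√(2 * Real.pi * τ) * √n) := by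
      field_simp
    rw [e1, ← one_div, div_le_div_iff₀ (by positivity) (by positivity)]
    calc 1 * (√(2 * Real.pi * τ) * √n) ≤ 4 * r := by linarith
      _ = 2 * t * (r / t * 2) := by field_simp; ring
      _ ≤ _ := by gcongr
  have hsum : r ^ 2 / τ ≤ n := by rw [div_le_iff₀ hτ]; exact h2
  calc Real.exp (-(n * (Real.log (r / t) + 3)))
      ≤ Real.exp (-(Real.log (r / t) + 1)) ^ n * Real.exp (-n - r ^ 2 / τ) := by
        rw [← Real.exp_nat_mul, ← Real.exp_add, Real.exp_le_exp]
        nlinarith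
    _ ≤ (2 * (t / √n) * (√(2 * Real.pi * τ))⁻¹) ^ n * Real.exp (-n - r ^ 2 / τ) := by
        gcongr
    _ = _ := by
        simp_rw [← mul_assoc]
        rw [Finset.prod_mul_distrib, ← Real.exp_sum, Finset.sum_sub_distrib, ← Finset.sum_div,
          hr, EuclideanSpace.real_norm_sq_eq]
        simp

/-! ### Averaging over `τ` -/

theorem IsClassF.integrableOn {M : ℝ} {f : ℝ → ℝ} (hf : IsClassF M f) :
    IntegrableOn f (Set.Ioi 0) := by
  by_contra h
  have := hf.integral_eq_one
  -- A non-integrable function has integral `0` by convention.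
  rw [integral_undef h] at this
  exact zero_ne_one this

theorem measurable_condLaw_real {n : ℕ} {s : Set (EuclideanSpace ℝ (Fin n))}
    (hs : MeasurableSet s) : Measurable fun τ => (condLaw n τ).real s :=
  ((Measure.measurable_coe hs).comp (measurable_condLaw n)).ennreal_toReal

theorem IsClassF.integrableOn_mul_condLaw_real {M : ℝ} {f : ℝ → ℝ} (hf : IsClassF M f) {n : ℕ}
    {s : Set (EuclideanSpace ℝ (Fin n))} (hs : MeasurableSet s) :
    IntegrableOn (fun τ => f τ * (condLaw n τ).real s) (Set.Ioi 0) := by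
  refine Integrable.mul_bdd (c := 1) hf.integrableOn
    (measurable_condLaw_real hs).aestronglyMeasurable (Eventually.of_forall fun τ => ?_)
  rw [Real.norm_eq_abs, abs_of_nonneg measureReal_nonneg]
  exact measureReal_le_one

theorem IsClassF.globalPrior_real_apply {M : ℝ} {f : ℝ → ℝ} (hf : IsClassF M f) {n : ℕ}
    {s : Set (EuclideanSpace ℝ (Fin n))} (hs : MeasurableSet s) :
    (globalPrior f n).real s = ∫ τ in Set.Ioi (0 : ℝ), f τ * (condLaw n τ).real s := by
  have hm : Measurable fun τ => condLaw n τ s :=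
    (Measure.measurable_coe hs).comp (measurable_condLaw n)
  rw [integral_eq_lintegral_of_nonneg_ae _
    (hf.integrableOn_mul_condLaw_real hs).aestronglyMeasurable, measureReal_def, globalPrior,
    Measure.bind_apply hs (condKernel n).measurable.aemeasurable]
  · congr 1
    change ∫⁻ τ, condLaw n τ s ∂(tauLaw f) = _
    rw [tauLaw, lintegral_withDensity_eq_lintegral_mul _ hf.measurable.ennreal_ofReal hm]
    refine setLIntegral_congr_fun measurableSet_Ioi fun τ hτ => ?_
    simp only [Pi.mul_apply]
    rw [ENNReal.ofReal_mul (hf.nonneg τ hτ), ofReal_measureReal]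
  · filter_upwards [ae_restrict_mem measurableSet_Ioi] with τ hτ
    exact mul_nonneg (hf.nonneg τ hτ) measureReal_nonneg

theorem IsClassF.globalPrior_real_le {M : ℝ} {f : ℝ → ℝ} (hf : IsClassF M f) {n : ℕ}
    {s : Set (EuclideanSpace ℝ (Fin n))} (hs : MeasurableSet s) {b : ℝ}
    (hb : ∀ τ, 0 < τ → (condLaw n τ).real s ≤ b) : (globalPrior f n).real s ≤ b := by
  calc (globalPrior f n).real s = ∫ τ in Set.Ioi (0 : ℝ), f τ * (condLaw n τ).real s :=
        hf.globalPrior_real_apply hs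
    _ ≤ ∫ τ in Set.Ioi (0 : ℝ), f τ * b :=
        setIntegral_mono_on (hf.integrableOn_mul_condLaw_real hs) (hf.integrableOn.mul_const b)
          measurableSet_Ioi fun τ hτ => mul_le_mul_of_nonneg_left (hb τ hτ) (hf.nonneg τ hτ)
    _ = b := by rw [integral_mul_const, hf.integral_eq_one, one_mul]

theorem IsClassF.le_globalPrior_real {M : ℝ} {f : ℝ → ℝ} (hf : IsClassF M f) {n : ℕ}
    {s : Set (EuclideanSpace ℝ (Fin n))} (hs : MeasurableSet s) {b u v : ℝ} (hb0 : 0 ≤ b)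
    (hu : 0 ≤ u) (huv : u ≤ v) (hv : v ≤ 1)
    (hb : ∀ τ, u < τ → τ < v → b ≤ (condLaw n τ).real s) :
    (v - u) * (1 / M * b) ≤ (globalPrior f n).real s := by
  have hsub : Set.Ioo u v ⊆ Set.Ioi 0 := fun τ hτ => hu.trans_lt hτ.1
  have hint := hf.integrableOn_mul_condLaw_real hs
  calc (v - u) * (1 / M * b) = ∫ τ in Set.Ioo u v, 1 / M * b := by
        rw [setIntegral_const, Real.volume_real_Ioo_of_le huv, smul_eq_mul]
    _ ≤ ∫ τ in Set.Ioo u v, f τ * (condLaw n τ).real s :=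
        setIntegral_mono_on (integrableOn_const (by simp)) (hint.mono_set hsub) measurableSet_Ioo fun τ hτ =>
          mul_le_mul (hf.lower_bound τ (hsub hτ) (hτ.2.trans_le hv)).le (hb τ hτ.1 hτ.2) hb0
            (hf.nonneg τ (hsub hτ))
    _ ≤ ∫ τ in Set.Ioi (0 : ℝ), f τ * (condLaw n τ).real s := by
        refine setIntegral_mono_set hint ?_ hsub.eventuallyLE
        filter_upwards [ae_restrict_mem measurableSet_Ioi] with τ hτ
        exact mul_nonneg (hf.nonneg τ hτ) measureReal_nonneg
    _ = (globalPrior f n).real s := (hf.globalPrior_real_apply hs).symm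

/-! ### Balls centred at the origin -/

theorem integral_Ioi_inv_sqrt_one_add_mul_pow {n : ℕ} (hn : 3 ≤ n) {c : ℝ} (hc : 0 < c) :
    IntegrableOn (fun τ => (√(1 + c * τ))⁻¹ ^ n) (Set.Ioi 0) ∧
      ∫ τ in Set.Ioi (0 : ℝ), (√(1 + c * τ))⁻¹ ^ n = 2 / (c * (n - 2)) := by
  have hn3 : (3 : ℝ) ≤ n := by exact_mod_cast hn
  set p : ℝ := -((n : ℝ) / 2) with hp
  have hp1 : p < -1 := by rw [hp]; linarith
  have heq : ∀ τ ∈ Set.Ioi (0 : ℝ), (1 + c * τ) ^ p = (√(1 + c * τ))⁻¹ ^ n := by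
    intro τ hτ
    have h0 : 0 < 1 + c * τ := by have := mul_pos hc hτ; linarith
    rw [Real.sqrt_eq_rpow, ← Real.rpow_neg h0.le, ← Real.rpow_natCast, ← Real.rpow_mul h0.le, hp]
    congr 1
    ring
  have hd : ∀ τ ∈ Set.Ici (0 : ℝ),
      HasDerivAt (fun τ => (1 + c * τ) ^ (p + 1) / (c * (p + 1))) ((1 + c * τ) ^ p) τ := by
    intro τ hτ
    have h0 : 0 < 1 + c * τ := by have := mul_nonneg hc.le hτ; linarith
    have h1 : HasDerivAt (fun τ => 1 + c * τ) c τ := by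
      simpa using ((hasDerivAt_id τ).const_mul c).const_add 1
    have hp0 : p + 1 ≠ 0 := by linarith
    have h2 := (h1.rpow_const (p := p + 1) (Or.inl h0.ne')).div_const (c * (p + 1))
    rwa [add_sub_cancel_right, mul_div_right_comm, div_self (mul_ne_zero hc.ne' hp0),
      one_mul] at h2
  have hpos : ∀ τ ∈ Set.Ioi (0 : ℝ), 0 ≤ (1 + c * τ) ^ p := fun τ hτ =>
    Real.rpow_nonneg (by have := mul_pos hc hτ; linarith) _
  have hlim : Tendsto (fun τ => (1 + c * τ) ^ (p + 1) / (c * (p + 1))) atTop (nhds 0) := by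
    have h1 : Tendsto (fun τ => 1 + c * τ) atTop atTop :=
      tendsto_atTop_add_const_left _ _ (tendsto_id.const_mul_atTop hc)
    have h2 := (tendsto_rpow_neg_atTop (y := -(p + 1)) (by linarith)).comp h1
    simpa using h2.div_const (c * (p + 1))
  constructor
  · exact (integrableOn_Ioi_deriv_of_nonneg' hd hpos hlim).congr_fun heq measurableSet_Ioi
  · rw [← setIntegral_congr_fun measurableSet_Ioi heq,
      integral_Ioi_of_hasDerivAt_of_nonneg' hd hpos hlim]
    have h1 : p + 1 = -((n - 2) / 2) := by rw [hp]; ring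
    have h2 : (n : ℝ) - 2 ≠ 0 := by linarith
    simp only [mul_zero, add_zero, Real.one_rpow, h1]
    field_simp
    ring

theorem IsClassF.globalPrior_real_centered_ball_le {M : ℝ} (hM : 0 < M) {f : ℝ → ℝ}
    (hf : IsClassF M f) {n : ℕ} (hn : 3 ≤ n) {t : ℝ} (ht : 0 < t) :
    (globalPrior f n).real {θ | ‖θ‖ < t} ≤ M * (Real.exp 1 * (t ^ 2 / (n - 2))) := by
  have hs : MeasurableSet {θ : EuclideanSpace ℝ (Fin n) | ‖θ‖ < t} :=
    measurableSet_lt (by fun_prop) (by fun_prop)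
  have hc : 0 < 2 * (1 / t ^ 2) := by positivity
  obtain ⟨hint, hval⟩ := integral_Ioi_inv_sqrt_one_add_mul_pow hn hc
  have hn3 : (3 : ℝ) ≤ n := by exact_mod_cast hn
  have hn2 : (n : ℝ) - 2 ≠ 0 := by linarith
  rw [hf.globalPrior_real_apply hs]
  calc ∫ τ in Set.Ioi (0 : ℝ), f τ * (condLaw n τ).real {θ | ‖θ‖ < t}
      ≤ ∫ τ in Set.Ioi (0 : ℝ), M * (Real.exp 1 * (√(1 + 2 * (1 / t ^ 2) * τ))⁻¹ ^ n) := by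
        refine setIntegral_mono_on (hf.integrableOn_mul_condLaw_real hs)
          ((hint.const_mul _).const_mul _) measurableSet_Ioi fun τ hτ => ?_
        refine mul_le_mul (hf.le_bound τ hτ) ?_ measureReal_nonneg hM.le
        -- This parameter makes the Chernoff prefactor the constant `e`.
        have h := condLaw_real_ball_le n hτ (l := 1 / t ^ 2) (by positivity) (t := t) 0
        have h1 : 1 / t ^ 2 * t ^ 2 = 1 := by field_simp
        simpa only [sub_zero, norm_zero, h1, ne_eq, OfNat.ofNat_ne_zero, not_false_eq_true,
          zero_pow, mul_zero, Real.exp_zero, mul_one] using h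
    _ = M * (Real.exp 1 * (t ^ 2 / (n - 2))) := by
        rw [integral_const_mul, integral_const_mul, hval]
        field_simp

theorem tRad_pos (δ : ℝ) {n : ℕ} (hn : 1 ≤ n) : 0 < tRad δ n :=
  Real.rpow_pos_of_pos (by exact_mod_cast hn) _

theorem one_le_tRad {δ : ℝ} (hδ : 0 ≤ δ) {n : ℕ} (hn : 1 ≤ n) : 1 ≤ tRad δ n :=
  Real.one_le_rpow (by exact_mod_cast hn) (by linarith)

theorem tRad_sq (δ : ℝ) {n : ℕ} (hn : 1 ≤ n) :
    tRad δ n ^ 2 = n * Real.exp (-(1 - δ) * Real.log n) := by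
  have hn0 : (0 : ℝ) < n := by exact_mod_cast hn
  have h : (n : ℝ) * Real.exp (-(1 - δ) * Real.log n)
      = Real.exp (Real.log n + -(1 - δ) * Real.log n) := by rw [Real.exp_add, Real.exp_log hn0]
  rw [h, tRad, ← Real.rpow_natCast, ← Real.rpow_mul hn0.le, Real.rpow_def_of_pos hn0]
  congr 1
  push_cast
  ring

theorem IsClassF.le_globalPrior_real_centered_ball {M : ℝ} (hM : 0 < M) {f : ℝ → ℝ}
    (hf : IsClassF M f) {δ : ℝ} (hδ : δ < 1) {n : ℕ} (hn : 1 ≤ n) :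
    1 / (4 * M) * Real.exp (-(1 - δ) * Real.log n)
      ≤ (globalPrior f n).real {θ | ‖θ‖ < tRad δ n} := by
  have hn0 : (0 : ℝ) < n := by exact_mod_cast hn
  set E := Real.exp (-(1 - δ) * Real.log n) with hE
  have hE0 : 0 < E := Real.exp_pos _
  have hE1 : E ≤ 1 := by
    rw [hE, Real.exp_le_one_iff]
    nlinarith [Real.log_nonneg (show (1 : ℝ) ≤ n by exact_mod_cast hn)]
  -- Since `t² = nE`, the window `τ < E/2` is where `2nτ ≤ t²`.
  have h := hf.le_globalPrior_real (n := n) (s := {θ | ‖θ‖ < tRad δ n})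
    (measurableSet_lt (by fun_prop) (by fun_prop)) (b := 1 / 2) (u := 0) (v := E / 2)
    (by norm_num) le_rfl (by positivity) (by linarith) fun τ h0 h1 =>
      half_le_condLaw_real_ball n h0 (tRad_pos δ hn) (by rw [tRad_sq δ hn]; nlinarith)
  refine le_trans (le_of_eq ?_) h
  field_simp
  ring

theorem IsClassF.globalPrior_real_centered_ball_tRad_le {M : ℝ} (hM : 0 < M) {f : ℝ → ℝ}
    (hf : IsClassF M f) {δ : ℝ} (hδ : 0 < δ) {n : ℕ} (hn : 1 ≤ n) :
    (globalPrior f n).real {θ | ‖θ‖ < tRad δ n}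
      ≤ (2 + 3 * M * Real.exp 1) * Real.exp (-(1 - δ) * Real.log n) := by
  have hn0 : (1 : ℝ) ≤ n := by exact_mod_cast hn
  have hE0 : 0 < Real.exp (-(1 - δ) * Real.log n) := Real.exp_pos _
  have he : 0 < M * Real.exp 1 := by positivity
  rcases le_or_gt 3 n with h3 | h3
  · refine (hf.globalPrior_real_centered_ball_le hM h3 (tRad_pos δ hn)).trans ?_
    have hn3 : (3 : ℝ) ≤ n := by exact_mod_cast h3
    have h1 : (n : ℝ) / (n - 2) ≤ 3 := by
      rw [div_le_iff₀ (by linarith)]; linarith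
    rw [tRad_sq δ hn, mul_comm (n : ℝ), mul_div_assoc]
    nlinarith [mul_pos he hE0]
  -- For `n ≤ 2` the `τ`-integral diverges, but `t ≥ 1` makes `2 exp(-(1-δ) log n) ≥ 1`, which the
  -- summand `2` covers.
  · have hle : (globalPrior f n).real {θ | ‖θ‖ < tRad δ n} ≤ 1 :=
      hf.globalPrior_real_le (measurableSet_lt (by fun_prop) (by fun_prop))
        fun τ _ => measureReal_le_one
    have hn2 : (n : ℝ) ≤ 2 := by exact_mod_cast Nat.lt_succ_iff.1 h3
    have h2 : 1 ≤ n * Real.exp (-(1 - δ) * Real.log n) := by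
      rw [← tRad_sq δ hn]
      exact one_le_pow₀ (one_le_tRad hδ.le hn)
    nlinarith [mul_pos he hE0]

/-! ### Balls away from the origin -/

theorem IsClassF.priorConc_le {M : ℝ} {f : ℝ → ℝ} (hf : IsClassF M f) {n : ℕ} {t : ℝ}
    (ht : 0 < t) (θ₀ : EuclideanSpace ℝ (Fin n)) (h : t < ‖θ₀‖) :
    priorConc f n θ₀ t ≤ Real.exp (-(n * Real.log (‖θ₀‖ / t))) := by
  rw [Real.exp_neg, Real.exp_nat_mul, Real.exp_log (div_pos (ht.trans h) ht), ← inv_pow]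
  exact hf.globalPrior_real_le (measurableSet_lt (by fun_prop) (by fun_prop))
    fun τ hτ => condLaw_real_ball_le_div_pow n hτ ht θ₀ h

theorem IsClassF.le_priorConc {M : ℝ} (hM : 0 < M) {f : ℝ → ℝ} (hf : IsClassF M f) {n : ℕ}
    (hn : 1 ≤ n) {t : ℝ} (ht : 1 ≤ t) (θ₀ : EuclideanSpace ℝ (Fin n)) (h1 : t ≤ ‖θ₀‖)
    (h2 : 2 * ‖θ₀‖ ^ 2 ≤ n) :
    Real.exp (-(n * (Real.log (‖θ₀‖ / t) + 4 + M))) ≤ priorConc f n θ₀ t := by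
  have hn0 : (0 : ℝ) < n := by exact_mod_cast hn
  have hr : 1 ≤ ‖θ₀‖ := ht.trans h1
  have h := hf.le_globalPrior_real (n := n) (s := {θ | ‖θ - θ₀‖ < t})
    (measurableSet_lt (by fun_prop) (by fun_prop))
    (b := Real.exp (-(n * (Real.log (‖θ₀‖ / t) + 3)))) (u := ‖θ₀‖ ^ 2 / n)
    (v := 2 * ‖θ₀‖ ^ 2 / n) (by positivity) (by positivity) (by gcongr; nlinarith)
    (by rwa [div_le_one hn0]) fun τ hu hv => by
      have hτ : 0 < τ := lt_of_le_of_lt (by positivity) hu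
      rw [div_lt_iff₀ hn0] at hu
      rw [lt_div_iff₀ hn0] at hv
      exact le_condLaw_real_ball hn hτ (by linarith) θ₀ h1 (by linarith) (by linarith)
  refine le_trans ?_ h
  -- The window has prior mass at least `‖θ₀‖²/(nM) ≥ 1/(nM)`, using `‖θ₀‖ ≥ t ≥ 1`; this costs only
  -- the extra `1 + M` in the exponent.
  have hw : Real.exp (-(n * (1 + M))) ≤
      (2 * ‖θ₀‖ ^ 2 / n - ‖θ₀‖ ^ 2 / n) * (1 / M) := by
    have e1 : (2 * ‖θ₀‖ ^ 2 / n - ‖θ₀‖ ^ 2 / n) * (1 / M) = ‖θ₀‖ ^ 2 / (n * M) := by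
      field_simp; ring
    have e2 : (n : ℝ) * M ≤ Real.exp (n * (1 + M)) := by
      nlinarith [Real.add_one_le_exp (n * (1 + M) : ℝ)]
    rw [e1, Real.exp_neg, ← one_div]
    exact div_le_div₀ (by positivity) (one_le_pow₀ hr) (by positivity) e2
  calc Real.exp (-(n * (Real.log (‖θ₀‖ / t) + 4 + M)))
      = Real.exp (-(n * (1 + M))) * Real.exp (-(n * (Real.log (‖θ₀‖ / t) + 3))) := by
        rw [← Real.exp_add]; congr 1; ring
    _ ≤ _ := by
        rw [← mul_assoc]
        gcongr

theorem mainTheorem1 (M : ℝ) (hM : 0 < M) :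
    ∃ C₁ C₂ c₂ : ℝ, 0 < C₁ ∧ 0 < C₂ ∧ 0 < c₂ ∧
      ∀ δ : ℝ, 0 < δ → δ < 1 →
        (∀ f : ℝ → ℝ, IsClassF M f → ∀ n : ℕ, 1 ≤ n →
          (C₁ * Real.exp (-(1 - δ) * Real.log n)
              ≤ (globalPrior f n).real {θ | ‖θ‖ < tRad δ n} ∧
            (globalPrior f n).real {θ | ‖θ‖ < tRad δ n}
              ≤ C₂ * Real.exp (-(1 - δ) * Real.log n)) ∧
          ∀ θ₀ : EuclideanSpace ℝ (Fin n), tRad δ n < ‖θ₀‖ →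
            priorConc f n θ₀ (tRad δ n)
              ≤ Real.exp (-c₂ * n * Real.log (‖θ₀‖ / tRad δ n))) ∧
        ∀ η : ℝ, 0 < η → ∃ c₁ : ℝ, 0 < c₁ ∧
          ∀ θ₀ : (n : ℕ) → EuclideanSpace ℝ (Fin n),
            (fun n => ‖θ₀ n‖) =o[atTop] (fun n : ℕ => Real.sqrt n) →
            ∀ᶠ n : ℕ in atTop, ∀ f : ℝ → ℝ, IsClassF M f →
              (1 + η) * tRad δ n ≤ ‖θ₀ n‖ →
              Real.exp (-c₁ * n * Real.log (‖θ₀ n‖ / tRad δ n))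
                ≤ priorConc f n (θ₀ n) (tRad δ n) := by
  refine ⟨1 / (4 * M), 2 + 3 * M * Real.exp 1, 1, by positivity, by positivity, one_pos,
    fun δ hδ0 hδ1 => ⟨fun f hf n hn => ⟨⟨hf.le_globalPrior_real_centered_ball hM hδ1 hn,
      hf.globalPrior_real_centered_ball_tRad_le hM hδ0 hn⟩, fun θ₀ h => ?_⟩, fun η hη => ?_⟩⟩
  · refine (hf.priorConc_le (tRad_pos δ hn) θ₀ h).trans (le_of_eq ?_)
    congr 1
    ring
  · have hL : 0 < Real.log (1 + η) := Real.log_pos (by linarith)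
    -- As `log a ≥ log(1 + η)`, the second summand times `log a` dominates `4 + M`.
    refine ⟨1 + (4 + M) / Real.log (1 + η), by positivity, fun θ₀ ho => ?_⟩
    filter_upwards [ho.def (c := 1 / 2) (by norm_num), eventually_ge_atTop 1] with n hn2 hn f hf ha
    have ht := one_le_tRad hδ0.le hn
    have hlog : Real.log (1 + η) ≤ Real.log (‖θ₀ n‖ / tRad δ n) :=
      Real.log_le_log (by linarith) (by rwa [le_div_iff₀ (by linarith)])
    rw [norm_norm, Real.norm_eq_abs, abs_of_nonneg (Real.sqrt_nonneg _)] at hn2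
    have hsq : 2 * ‖θ₀ n‖ ^ 2 ≤ n := by
      nlinarith [Real.sq_sqrt (Nat.cast_nonneg (α := ℝ) n), Real.sqrt_nonneg (n : ℝ),
        norm_nonneg (θ₀ n), pow_le_pow_left₀ (norm_nonneg (θ₀ n)) hn2 2]
    refine le_trans ?_ (hf.le_priorConc hM hn ht (θ₀ n) (by nlinarith) hsq)
    rw [Real.exp_le_exp]
    have h4 : 4 + M ≤ (4 + M) / Real.log (1 + η) * Real.log (‖θ₀ n‖ / tRad δ n) := by
      rw [div_mul_eq_mul_div, le_div_iff₀ hL]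
      exact mul_le_mul_of_nonneg_left hlog (by linarith)
    nlinarith [mul_le_mul_of_nonneg_left h4 (Nat.cast_nonneg (α := ℝ) n)]
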